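/- For a unital algebra $\mathcal A$ over a field and a finite-dimensional subspace $V\subseteq\mathcal A$ put $V_n=\sum_{k=0}^n V^k$, where $V^0$ is the span of $1$. The algebra $\mathcal A$ has *polynomial growth* if for every finite-dimensional $V$ there is $\gamma>0$ with $\dim V_n=O(n^\gamma)$, and *subexponential growth* if $\lim_{n\to\infty}(\dim V_n)^{1/n}=1$ for every finite-dimensional $V$. Its Gelfand–Kirillov dimension is $\operatorname{GKdim}(\mathcal A)=\sup_V\limsup_{n\to\infty}\frac{\log\dim V_n}{\log n}\in[0,\infty]$. A *compact quantum group* $G=(Q,\Delta)$ consists of a nonzero unital $C^*$-algebra $Q$ and a coassociative unital $^*$-homomorphism $\Delta:Q\to Q\otimes Q$ (minimal tensor product) such that the linear spans of $(1\otimes Q)\Delta(Q)$ and $(Q\otimes 1)\Delta(Q)$ are dense. Let $\mathcal Q_G\subseteq Q$ be the Hopf $^*$-algebra spanned by the matrix coefficients of the finite-dimensional unitary representations of $G$. A compact quantum group $H$ is a *quantum subgroup* of $G$ if there is a surjective homomorphism of Hopf $^*$-algebras $\mathcal Q_G\to\mathcal Q_H$, and a *quotient* of $G$ if there is an injective homomorphism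 of Hopf $^*$-algebras $\mathcal Q_H\to\mathcal Q_G$. If $\mathcal Q_G$ has polynomial growth, the topological dimension of $G$ is $\dim G=\operatorname{GKdim}(\mathcal Q_G)$. **Proposition.** Let $G$ be a compact quantum group and let $H$ be a quantum subgroup or a quotient of $G$. If $\mathcal Q_G$ has polynomial growth, then so does $\mathcal Q_H$, and $\dim H\le\dim G$. If $\mathcal Q_G$ has subexponential growth, then so does $\mathcal Q_H$. -/

import Mathlib

open scoped TensorProduct ENNReal Topology

noncomputable section

universe u v

/-! ### The minimal (spatial) tensor product of unital C⋆-algebras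

Mathlib does not have it. It is built as the norm closure of the image of the algebraic tensor
product `A ⊗ B` under the direct sum of all `π_φ ⊗ π_ψ`, where `φ`, `ψ` run over the states of `A`
and `B` and `π_φ`, `π_ψ` are their GNS representations; that is, as the spatial tensor product
in the universal representations of `A` and `B`. -/

namespace CStarTensor

/-- The states of a unital C⋆-algebra: positive linear functionals `φ` with `φ 1 = 1`. Positivity
is understood with respect to the canonical order of the C⋆-algebra. -/
def State (A : Type u) [CStarAlgebra A] : Type u :=
  letI := CStarAlgebra.spectralOrder A
  letI := Complex.partialOrder
  {φ : A →ₚ[ℂ] ℂ // φ 1 = 1}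

section GNS

variable {A : Type u} [CStarAlgebra A]

/-- The GNS Hilbert space of a state. -/
def Hilb (φ : State A) : Type u :=
  letI := CStarAlgebra.spectralOrder A
  letI := CStarAlgebra.spectralOrderedRing A
  φ.1.GNS

instance (φ : State A) : NormedAddCommGroup (Hilb φ) :=
  letI := CStarAlgebra.spectralOrder A
  letI := CStarAlgebra.spectralOrderedRing A
  inferInstanceAs (NormedAddCommGroup φ.1.GNS)

instance (φ : State A) : InnerProductSpace ℂ (Hilb φ) :=
  letI := CStarAlgebra.spectralOrder A
  letI := CStarAlgebra.spectralOrderedRing A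
  inferInstanceAs (InnerProductSpace ℂ φ.1.GNS)

instance (φ : State A) : CompleteSpace (Hilb φ) :=
  letI := CStarAlgebra.spectralOrder A
  letI := CStarAlgebra.spectralOrderedRing A
  inferInstanceAs (CompleteSpace φ.1.GNS)

/-- The GNS representation of a state. -/
def gns (φ : State A) : A →⋆ₐ[ℂ] (Hilb φ →L[ℂ] Hilb φ) :=
  letI := CStarAlgebra.spectralOrder A
  letI := CStarAlgebra.spectralOrderedRing A
  φ.1.gnsStarAlgHom

instance (φ : State A) : Nontrivial (Hilb φ) := by
  let _ := CStarAlgebra.spectralOrder A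
  have _ := CStarAlgebra.spectralOrderedRing A
  refine ⟨⟨((φ.1.toPreGNS 1 : φ.1.PreGNS) : φ.1.GNS), (0 : φ.1.GNS), fun h => ?_⟩⟩
  have h1 : ‖((φ.1.toPreGNS 1 : φ.1.PreGNS) : φ.1.GNS)‖ = 1 := by
    rw [UniformSpace.Completion.norm_coe, PositiveLinearMap.preGNS_norm_def]
    simp [φ.2]
  rw [h] at h1
  simp at h1

end GNS

section Spatial

variable {A : Type u} {B : Type v} [CStarAlgebra A] [CStarAlgebra B]

/-- The Hilbert space tensor product of two GNS spaces. -/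
abbrev Hilb₂ (i : State A × State B) : Type (max u v) :=
  UniformSpace.Completion (Hilb i.1 ⊗[ℂ] Hilb i.2)

instance (i : State A × State B) : Nontrivial (Hilb₂ i) := by
  obtain ⟨x, hx⟩ := exists_ne (0 : Hilb i.1)
  obtain ⟨y, hy⟩ := exists_ne (0 : Hilb i.2)
  refine ⟨⟨((x ⊗ₜ[ℂ] y : Hilb i.1 ⊗[ℂ] Hilb i.2) : Hilb₂ i), 0, fun h => ?_⟩⟩
  have h1 : ‖((x ⊗ₜ[ℂ] y : Hilb i.1 ⊗[ℂ] Hilb i.2) : Hilb₂ i)‖ = ‖x‖ * ‖y‖ := by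
    rw [UniformSpace.Completion.norm_coe, TensorProduct.norm_tmul]
  rw [h, norm_zero] at h1
  exact mul_ne_zero (norm_ne_zero_iff.2 hx) (norm_ne_zero_iff.2 hy) h1.symm

/-- The C⋆-algebra of bounded operators on `Hilb₂ i`. -/
def Op (i : State A × State B) : Type (max u v) := Hilb₂ i →L[ℂ] Hilb₂ i

instance (i : State A × State B) : CStarAlgebra (Op i) :=
  inferInstanceAs (CStarAlgebra (Hilb₂ i →L[ℂ] Hilb₂ i))

instance (i : State A × State B) : Nontrivial (Op i) :=
  inferInstanceAs (Nontrivial (Hilb₂ i →L[ℂ] Hilb₂ i))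

/-- The bounded operator `S ⊗ T` on the Hilbert space tensor product. -/
def opTensor (i : State A × State B) (S : Hilb i.1 →L[ℂ] Hilb i.1)
    (T : Hilb i.2 →L[ℂ] Hilb i.2) : Hilb₂ i →L[ℂ] Hilb₂ i :=
  (TensorProduct.mapL S T).completion

@[simp] theorem opTensor_coe (i : State A × State B) (S : Hilb i.1 →L[ℂ] Hilb i.1)
    (T : Hilb i.2 →L[ℂ] Hilb i.2) (x : Hilb i.1 ⊗[ℂ] Hilb i.2) :
    opTensor i S T (x : Hilb₂ i) = ((TensorProduct.mapL S T x : Hilb i.1 ⊗[ℂ] Hilb i.2) : Hilb₂ i) := by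
  simp [opTensor]

theorem op_ext {i : State A × State B} {S T : Hilb₂ i →L[ℂ] Hilb₂ i}
    (h : ∀ x : Hilb i.1 ⊗[ℂ] Hilb i.2, S (x : Hilb₂ i) = T (x : Hilb₂ i)) : S = T := by
  ext x
  induction x using UniformSpace.Completion.induction_on with
  | hp => exact isClosed_eq S.continuous T.continuous
  | ih x => exact h x

theorem opTensor_mul (i : State A × State B) (S S' : Hilb i.1 →L[ℂ] Hilb i.1)
    (T T' : Hilb i.2 →L[ℂ] Hilb i.2) :
    opTensor i (S * S') (T * T') = opTensor i S T * opTensor i S' T' := by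
  refine op_ext fun x => ?_
  rw [mul_apply_eq_comp, opTensor_coe, opTensor_coe, opTensor_coe,
    TensorProduct.mapL_mul, mul_apply_eq_comp]

theorem opTensor_one (i : State A × State B) : opTensor i 1 1 = 1 := by
  refine op_ext fun x => ?_
  rw [opTensor_coe]
  change ((TensorProduct.mapL (.id ℂ _) (.id ℂ _) x : Hilb i.1 ⊗[ℂ] Hilb i.2) : Hilb₂ i) = _
  rw [TensorProduct.mapL_id_id]
  rfl

theorem opTensor_star (i : State A × State B) (S : Hilb i.1 →L[ℂ] Hilb i.1)
    (T : Hilb i.2 →L[ℂ] Hilb i.2) :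
    opTensor i (star S) (star T) = star (opTensor i S T) := by
  rw [ContinuousLinearMap.star_eq_adjoint, ContinuousLinearMap.star_eq_adjoint,
    ContinuousLinearMap.star_eq_adjoint, ContinuousLinearMap.eq_adjoint_iff]
  intro x y
  induction x, y using UniformSpace.Completion.induction_on₂ with
  | hp => apply isClosed_eq <;> fun_prop
  | ih x y =>
    rw [opTensor_coe, opTensor_coe, UniformSpace.Completion.inner_coe,
      UniformSpace.Completion.inner_coe]
    induction x using TensorProduct.induction_on with
    | zero => simp
    | add x x' hx hx' => simp only [map_add, inner_add_left, hx, hx']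
    | tmul a b =>
      induction y using TensorProduct.induction_on with
      | zero => simp
      | add y y' hy hy' => simp only [map_add, inner_add_right, hy, hy']
      | tmul c d =>
        simp only [TensorProduct.mapL_tmul, TensorProduct.inner_tmul,
          ContinuousLinearMap.adjoint_inner_left]

/-- `opTensor` as a bilinear map. -/
def opTensorBilin (i : State A × State B) :
    (Hilb i.1 →L[ℂ] Hilb i.1) →ₗ[ℂ] (Hilb i.2 →L[ℂ] Hilb i.2) →ₗ[ℂ] (Hilb₂ i →L[ℂ] Hilb₂ i) :=
  LinearMap.mk₂ ℂ (opTensor i)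
    (fun S S' T => op_ext fun x => by
      simp [TensorProduct.mapL_add_left, UniformSpace.Completion.coe_add])
    (fun c S T => op_ext fun x => by
      simp [TensorProduct.mapL_smul_left, UniformSpace.Completion.coe_smul])
    (fun S T T' => op_ext fun x => by
      simp [TensorProduct.mapL_add_right, UniformSpace.Completion.coe_add])
    (fun c S T => op_ext fun x => by
      simp [TensorProduct.mapL_smul_right, UniformSpace.Completion.coe_smul])

theorem norm_opTensor_le (i : State A × State B) (S : Hilb i.1 →L[ℂ] Hilb i.1)
    (T : Hilb i.2 →L[ℂ] Hilb i.2) : ‖opTensor i S T‖ ≤ ‖S‖ * ‖T‖ := by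
  refine ContinuousLinearMap.opNorm_le_bound _ (by positivity) fun x => ?_
  induction x using UniformSpace.Completion.induction_on with
  | hp => apply isClosed_le <;> fun_prop
  | ih x =>
    rw [opTensor_coe, UniformSpace.Completion.norm_coe, UniformSpace.Completion.norm_coe]
    exact (ContinuousLinearMap.le_opNorm _ _).trans
      (mul_le_mul_of_nonneg_right (TensorProduct.norm_mapL_le _ _) (norm_nonneg _))

/-- The representation `π_φ ⊗ π_ψ` of the algebraic tensor product, as a linear map. -/
def repLinear (i : State A × State B) : A ⊗[ℂ] B →ₗ[ℂ] (Hilb₂ i →L[ℂ] Hilb₂ i) :=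
  TensorProduct.lift ((opTensorBilin i).compl₁₂
    (gns i.1).toAlgHom.toLinearMap (gns i.2).toAlgHom.toLinearMap)

@[simp] theorem repLinear_tmul (i : State A × State B) (a : A) (b : B) :
    repLinear i (a ⊗ₜ b) = opTensor i (gns i.1 a) (gns i.2 b) := rfl

theorem repLinear_mul (i : State A × State B) (a a' : A) (b b' : B) :
    repLinear i ((a * a') ⊗ₜ (b * b')) = repLinear i (a ⊗ₜ b) * repLinear i (a' ⊗ₜ b') := by
  simp only [repLinear_tmul, map_mul, opTensor_mul]

theorem repLinear_one (i : State A × State B) : repLinear i ((1 : A) ⊗ₜ (1 : B)) = 1 := by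
  simp only [repLinear_tmul, map_one, opTensor_one]

theorem repLinear_star (i : State A × State B) (x : A ⊗[ℂ] B) :
    repLinear i (star x) = star (repLinear i x) := by
  induction x using TensorProduct.induction_on with
  | zero => rw [star_zero, map_zero]; exact (star_zero (Op i)).symm
  | add x y hx hy =>
    rw [star_add, map_add, hx, hy, map_add]
    exact (star_add (R := Op i) (repLinear i x) (repLinear i y)).symm
  | tmul a b => simp only [TensorProduct.star_tmul, repLinear_tmul, map_star, opTensor_star]

/-- The representation `π_φ ⊗ π_ψ` of the algebraic tensor product on the Hilbert space tensor
product: `(π_φ ⊗ π_ψ) (a ⊗ b) = π_φ a ⊗ π_ψ b`. -/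
def rep (i : State A × State B) : A ⊗[ℂ] B →⋆ₐ[ℂ] Op i where
  toAlgHom := Algebra.TensorProduct.algHomOfLinearMapTensorProduct (repLinear i)
    (repLinear_mul i) (repLinear_one i)
  map_star' x := repLinear_star i x

theorem rep_tmul (i : State A × State B) (a : A) (b : B) :
    rep i (a ⊗ₜ b) = opTensor i (gns i.1 a) (gns i.2 b) := rfl

/-- The ℓ^∞-direct sum of a family of C⋆-algebras. -/
abbrev BlockSum {I : Type*} (C : I → Type*) [∀ i, CStarAlgebra (C i)] := lp C ∞

instance {I : Type*} (C : I → Type*) [∀ i, CStarAlgebra (C i)] [∀ i, Nontrivial (C i)] :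
    CStarAlgebra (BlockSum C) where

variable (A B) in
/-- The ℓ^∞-direct sum of the algebras of bounded operators on the spaces of all `π_φ ⊗ π_ψ`
(block diagonal operators on the direct sum of these spaces). -/
abbrev Ambient : Type (max u v) := BlockSum (fun i : State A × State B => Op i)

theorem norm_rep_tmul_le (i : State A × State B) (a : A) (b : B) :
    ‖rep i (a ⊗ₜ b)‖ ≤ ‖a‖ * ‖b‖ :=
  (norm_opTensor_le i _ _).trans (mul_le_mul
    (NonUnitalStarAlgHom.norm_apply_le (gns i.1) a)
    (NonUnitalStarAlgHom.norm_apply_le (gns i.2) b) (norm_nonneg _) (norm_nonneg _))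

theorem rep_memℓp (x : A ⊗[ℂ] B) : Memℓp (fun i : State A × State B => rep i x) ∞ := by
  induction x using TensorProduct.induction_on with
  | zero =>
    simp only [map_zero]
    exact zero_memℓp
  | add x y hx hy =>
    simp only [map_add]
    exact hx.add hy
  | tmul a b =>
    refine memℓp_infty ⟨‖a‖ * ‖b‖, ?_⟩
    rintro _ ⟨i, rfl⟩
    exact norm_rep_tmul_le i a b

variable (A B) in
/-- The direct sum of all `π_φ ⊗ π_ψ`. -/
def univRep : A ⊗[ℂ] B →⋆ₐ[ℂ] Ambient A B where
  toFun x := ⟨fun i => rep i x, rep_memℓp x⟩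
  map_one' := Subtype.ext <| funext fun i => map_one (rep i)
  map_mul' x y := Subtype.ext <| funext fun i => map_mul (rep i) x y
  map_zero' := Subtype.ext <| funext fun i => map_zero (rep i)
  map_add' x y := Subtype.ext <| funext fun i => map_add (rep i) x y
  commutes' c := Subtype.ext <| funext fun i => AlgHomClass.commutes (rep i) c
  map_star' x := Subtype.ext <| funext fun i => map_star (rep i) x

end Spatial

end CStarTensor

open CStarTensor in
/-- The minimal (spatial) C⋆-tensor product of two unital C⋆-algebras: the norm closure of the
image of the algebraic tensor product under the direct sum of the representations `π_φ ⊗ π_ψ`. -/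
def MinTensor (A : Type u) (B : Type v) [CStarAlgebra A] [CStarAlgebra B] : Type (max u v) :=
  (univRep A B).range.topologicalClosure

namespace MinTensor

open CStarTensor

variable {A : Type u} {B : Type v} [CStarAlgebra A] [CStarAlgebra B]

instance : CStarAlgebra (MinTensor A B) :=
  haveI : IsClosed ((univRep A B).range.topologicalClosure : Set (Ambient A B)) :=
    StarSubalgebra.isClosed_topologicalClosure _
  inferInstanceAs (CStarAlgebra (univRep A B).range.topologicalClosure)

variable (A B) in
/-- The canonical map from the algebraic to the minimal tensor product. -/
def ofAlg : A ⊗[ℂ] B →⋆ₐ[ℂ] MinTensor A B :=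
  (StarSubalgebra.inclusion (univRep A B).range.le_topologicalClosure).comp
    (univRep A B).rangeRestrict

/-- The elementary tensor `a ⊗ b` in the minimal tensor product. -/
def tmul (a : A) (b : B) : MinTensor A B := ofAlg A B (a ⊗ₜ b)

theorem ofAlg_tmul (a : A) (b : B) : ofAlg A B (a ⊗ₜ b) = tmul a b := rfl

theorem tmul_mul_tmul (a a' : A) (b b' : B) :
    tmul a b * tmul a' b' = tmul (a * a') (b * b') := by
  simp only [← ofAlg_tmul, ← map_mul, Algebra.TensorProduct.tmul_mul_tmul]

theorem tmul_one_one : tmul (1 : A) (1 : B) = 1 := map_one (ofAlg A B)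

end MinTensor

/-! ### Compact quantum groups -/

open MinTensor in
/-- Coassociativity `(Δ ⊗ id) Δ = (id ⊗ Δ) Δ`. Here `L` is `Δ ⊗ id`, `R` is `id ⊗ Δ` and `α` is the
associativity isomorphism of the minimal tensor product. These ⋆-homomorphisms always exist and are
determined by their values on elementary tensors. -/
def IsCoassociative {A : Type u} [CStarAlgebra A] (Δ : A →⋆ₐ[ℂ] MinTensor A A) : Prop :=
  ∃ (L : MinTensor A A →⋆ₐ[ℂ] MinTensor (MinTensor A A) A)
    (R : MinTensor A A →⋆ₐ[ℂ] MinTensor A (MinTensor A A))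
    (α : MinTensor (MinTensor A A) A ≃⋆ₐ[ℂ] MinTensor A (MinTensor A A)),
    (∀ a b, L (tmul a b) = tmul (Δ a) b) ∧
    (∀ a b, R (tmul a b) = tmul a (Δ b)) ∧
    (∀ a b c, α (tmul (tmul a b) c) = tmul a (tmul b c)) ∧
    ∀ a, α (L (Δ a)) = R (Δ a)

open MinTensor in
/-- A compact quantum group `G = (A, Δ)` in the sense of Woronowicz: a (nonzero) unital C⋆-algebra
`A`, thought of as `C(G)`, with a coassociative unital ⋆-homomorphism `Δ : A → A ⊗ A` into the
minimal tensor product such that `(1 ⊗ A) Δ(A)` and `(A ⊗ 1) Δ(A)` span dense subspaces. -/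
structure CompactQuantumGroup (A : Type u) [CStarAlgebra A] where
  nontrivial : Nontrivial A
  comul : A →⋆ₐ[ℂ] MinTensor A A
  coassoc : IsCoassociative comul
  dense_left : Dense (Submodule.span ℂ {x | ∃ a b : A, x = tmul 1 a * comul b} :
    Set (MinTensor A A))
  dense_right : Dense (Submodule.span ℂ {x | ∃ a b : A, x = tmul a 1 * comul b} :
    Set (MinTensor A A))

/-! ### Growth of algebras -/

namespace AlgebraGrowth

variable (k : Type u) (R : Type v) [Field k] [Ring R] [Algebra k R]

variable {k R} in
/-- `dim V_n`, where `V_n = ∑_{j=0}^n V^j` is spanned by the products of at most `n` elements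
of `V` (and `V^0 = k 1`). -/
def growth (V : Submodule k R) (n : ℕ) : ℕ :=
  Module.finrank k (∑ j ∈ Finset.range (n + 1), V ^ j : Submodule k R)

/-- Polynomial growth: for every finite-dimensional subspace `V` there is `γ > 0` with
`dim V_n = O(n^γ)`. -/
def HasPolynomialGrowth : Prop :=
  ∀ V : Submodule k R, FiniteDimensional k V →
    ∃ γ : ℝ, 0 < γ ∧ (fun n : ℕ => (growth V n : ℝ)) =O[Filter.atTop] fun n : ℕ => (n : ℝ) ^ γ

/-- Subexponential growth: for every finite-dimensional subspace `V`, `(dim V_n)^{1/n} → 1`. -/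
def HasSubexponentialGrowth : Prop :=
  ∀ V : Submodule k R, FiniteDimensional k V →
    Filter.Tendsto (fun n : ℕ => (growth V n : ℝ) ^ (1 / (n : ℝ))) Filter.atTop (𝓝 1)

/-- The Gelfand–Kirillov dimension: the supremum over all finite-dimensional subspaces `V` of
`limsup_n log (dim V_n) / log n`, possibly `+∞`. -/
def gkDim : EReal :=
  ⨆ (V : Submodule k R) (_ : FiniteDimensional k V),
    Filter.limsup (fun n : ℕ => ((Real.log (growth V n) / Real.log n : ℝ) : EReal)) Filter.atTop

end AlgebraGrowth

namespace CompactQuantumGroup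

open MinTensor

variable {A : Type u} {B : Type v} [CStarAlgebra A] [CStarAlgebra B]

/-- A unitary representation of `G` on a finite-dimensional Hilbert space, given by its matrix of
coefficients `u i j` in an orthonormal basis: `u` is unitary and
`Δ (u i j) = ∑ r, u i r ⊗ u r j`. -/
structure IsRep (G : CompactQuantumGroup A) {ι : Type} [Fintype ι] [DecidableEq ι]
    (u : Matrix ι ι A) : Prop where
  unitary : u ∈ unitary (Matrix ι ι A)
  comul : ∀ i j, G.comul (u i j) = ∑ r, tmul (u i r) (u r j)

/-- The matrix coefficients, in orthonormal bases, of the finite-dimensional unitary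
representations of `G`. -/
def coeffs (G : CompactQuantumGroup A) : Set A :=
  {a | ∃ (n : ℕ) (u : Matrix (Fin n) (Fin n) A), G.IsRep u ∧ ∃ i j, a = u i j}

theorem IsRep.mem_coeffs {G : CompactQuantumGroup A} {ι : Type} [Fintype ι] [DecidableEq ι]
    {u : Matrix ι ι A} (hu : G.IsRep u) (i j : ι) : u i j ∈ G.coeffs := by
  let e := Fintype.equivFin ι
  refine ⟨Fintype.card ι, u.submatrix e.symm e.symm, ⟨?_, fun i j => ?_⟩, e i, e j, by simp⟩
  · rw [Unitary.mem_iff, Matrix.star_eq_conjTranspose, Matrix.conjTranspose_submatrix,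
      Matrix.submatrix_mul_equiv, Matrix.submatrix_mul_equiv, ← Matrix.star_eq_conjTranspose,
      Unitary.star_mul_self_of_mem hu.unitary, Unitary.mul_star_self_of_mem hu.unitary]
    simp
  · rw [Matrix.submatrix_apply, hu.comul, ← e.symm.sum_comp]
    rfl

/-- The coefficients `u i j * u' i' j'` of the tensor product of two representations. -/
theorem IsRep.tensor {G : CompactQuantumGroup A} {ι κ : Type} [Fintype ι] [DecidableEq ι]
    [Fintype κ] [DecidableEq κ] {u : Matrix ι ι A} {w : Matrix κ κ A}
    (hu : G.IsRep u) (hw : G.IsRep w) :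
    G.IsRep (Matrix.of fun p q : ι × κ => u p.1 q.1 * w p.2 q.2) := by
  have hu1 := Unitary.star_mul_self_of_mem hu.unitary
  have hu2 := Unitary.mul_star_self_of_mem hu.unitary
  have hw1 := Unitary.star_mul_self_of_mem hw.unitary
  have hw2 := Unitary.mul_star_self_of_mem hw.unitary
  have hu1' : ∀ i j, ∑ r, star (u r i) * u r j = if i = j then 1 else 0 := fun i j => by
    simpa [Matrix.mul_apply, Matrix.one_apply] using congrFun (congrFun hu1 i) j
  have hu2' : ∀ i j, ∑ r, u i r * star (u j r) = if i = j then 1 else 0 := fun i j => by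
    simpa [Matrix.mul_apply, Matrix.one_apply] using congrFun (congrFun hu2 i) j
  have hw1' : ∀ i j, ∑ r, star (w r i) * w r j = if i = j then 1 else 0 := fun i j => by
    simpa [Matrix.mul_apply, Matrix.one_apply] using congrFun (congrFun hw1 i) j
  have hw2' : ∀ i j, ∑ r, w i r * star (w j r) = if i = j then 1 else 0 := fun i j => by
    simpa [Matrix.mul_apply, Matrix.one_apply] using congrFun (congrFun hw2 i) j
  refine ⟨Unitary.mem_iff.2 ⟨?_, ?_⟩, ?_⟩
  · ext p q
    have h : ∀ r s, star (u r p.1 * w s p.2) * (u r q.1 * w s q.2) =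
        star (w s p.2) * (star (u r p.1) * u r q.1) * w s q.2 := fun r s => by
      rw [star_mul]; noncomm_ring
    simp only [Matrix.mul_apply, Matrix.star_apply, Matrix.of_apply, Matrix.one_apply, h,
      Fintype.sum_prod_type_right, ← Finset.sum_mul, ← Finset.mul_sum, hu1', Prod.ext_iff]
    by_cases h1 : p.1 = q.1 <;> simp [h1, hw1']
  · ext p q
    have h : ∀ r s, u p.1 r * w p.2 s * star (u q.1 r * w q.2 s) =
        u p.1 r * (w p.2 s * star (w q.2 s)) * star (u q.1 r) := fun r s => by
      rw [star_mul]; noncomm_ring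
    simp only [Matrix.mul_apply, Matrix.star_apply, Matrix.of_apply, Matrix.one_apply, h,
      Fintype.sum_prod_type, ← Finset.sum_mul, ← Finset.mul_sum, hw2', Prod.ext_iff]
    by_cases h1 : p.2 = q.2 <;> simp [h1, hu2']
  · intro p q
    simp only [Matrix.of_apply, map_mul, hu.comul, hw.comul, Finset.sum_mul_sum, tmul_mul_tmul,
      Fintype.sum_prod_type]

/-- The trivial representation. -/
theorem isRep_one (G : CompactQuantumGroup A) : G.IsRep (1 : Matrix (Fin 1) (Fin 1) A) where
  unitary := one_mem _
  comul i j := by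
    obtain rfl := Subsingleton.elim i 0
    obtain rfl := Subsingleton.elim j 0
    simp [tmul_one_one]

/-- The algebra `Q_G`: the linear span in `A = C(G)` of the matrix coefficients of the
finite-dimensional unitary representations of `G`. -/
def polyAlg (G : CompactQuantumGroup A) : Subalgebra ℂ A :=
  (Submodule.span ℂ G.coeffs).toSubalgebra
    (Submodule.subset_span ⟨1, 1, G.isRep_one, 0, 0, by simp⟩)
    (fun x y hx hy => by
      have h := Submodule.mul_mem_mul hx hy
      rw [Submodule.span_mul_span] at h
      refine Submodule.span_mono ?_ h
      rintro _ ⟨_, ⟨n, u, hu, i, j, rfl⟩, _, ⟨m, w, hw, i', j', rfl⟩, rfl⟩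
      exact (hu.tensor hw).mem_coeffs (i, i') (j, j'))

/-- The canonical map `Q_G ⊗ Q_G → C(G) ⊗ C(G)`. -/
def polyTensor (G : CompactQuantumGroup A) : G.polyAlg ⊗[ℂ] G.polyAlg →ₐ[ℂ] MinTensor A A :=
  (ofAlg A A).toAlgHom.comp (Algebra.TensorProduct.map G.polyAlg.val G.polyAlg.val)

/-- The coproduct maps `Q_G` into `Q_G ⊗ Q_G`. -/
theorem exists_comul_eq (G : CompactQuantumGroup A) (a : G.polyAlg) :
    ∃ t, G.comul (a : A) = G.polyTensor t := by
  obtain ⟨a, ha⟩ := a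
  change a ∈ Submodule.span ℂ G.coeffs at ha
  induction ha using Submodule.span_induction with
  | mem x hx =>
    obtain ⟨n, u, hu, i, j, rfl⟩ := hx
    have hm : ∀ i j, u i j ∈ G.polyAlg := fun i j => Submodule.subset_span ⟨n, u, hu, i, j, rfl⟩
    refine ⟨∑ r, (⟨u i r, hm i r⟩ : G.polyAlg) ⊗ₜ[ℂ] (⟨u r j, hm r j⟩ : G.polyAlg), ?_⟩
    rw [map_sum]
    exact hu.comul i j
  | zero => exact ⟨0, by simp⟩
  | add x y _ _ hx hy =>
    obtain ⟨s, hs⟩ := hx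
    obtain ⟨t, ht⟩ := hy
    exact ⟨s + t, by rw [map_add G.polyTensor, ← hs, ← ht]; exact map_add G.comul x y⟩
  | smul c x _ hx =>
    obtain ⟨s, hs⟩ := hx
    exact ⟨c • s, by rw [map_smul G.polyTensor, ← hs]; exact map_smul G.comul c x⟩

/-- A homomorphism of Hopf ⋆-algebras `f : Q_G → Q_H`: a unital algebra homomorphism with
`f (a⋆) = (f a)⋆` and `Δ_H (f a) = (f ⊗ f) (Δ_G a)`. (Compatibility with counit and antipode is
automatic.) -/
structure HopfStarHom (G : CompactQuantumGroup A) (H : CompactQuantumGroup B) extends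
    G.polyAlg →ₐ[ℂ] H.polyAlg where
  map_star' : ∀ a b : G.polyAlg, (b : A) = star (a : A) → (toFun b : B) = star (toFun a : B)
  map_comul' : ∀ (a : G.polyAlg) (t : G.polyAlg ⊗[ℂ] G.polyAlg), G.comul (a : A) = G.polyTensor t →
    H.comul (toFun a : B) = H.polyTensor (Algebra.TensorProduct.map toAlgHom toAlgHom t)

/-- `H` is a (closed) quantum subgroup of `G`: there is a surjective Hopf ⋆-homomorphism
`Q_G → Q_H`, the restriction of functions from `G` to `H`. -/
def IsQuantumSubgroup (H : CompactQuantumGroup B) (G : CompactQuantumGroup A) : Prop :=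
  ∃ π : HopfStarHom G H, Function.Surjective π.toAlgHom

/-- `H` is a quotient quantum group of `G`: there is an injective Hopf ⋆-homomorphism
`Q_H → Q_G`, the pull-back of functions along `G → H`. -/
def IsQuantumQuotient (H : CompactQuantumGroup B) (G : CompactQuantumGroup A) : Prop :=
  ∃ θ : HopfStarHom H G, Function.Injective θ.toAlgHom

/-- The topological dimension of `G`, the Gelfand–Kirillov dimension of `Q_G`. -/
def topDim (G : CompactQuantumGroup A) : EReal := AlgebraGrowth.gkDim ℂ G.polyAlg

end CompactQuantumGroup

end

/-! The coproduct and the involution play no role: only an algebra homomorphism between `Q_G` and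
`Q_H` matters. A homomorphism `f` carries `V_n` onto `(f V)_n`. If `f : Q_G → Q_H` is surjective,
every finite-dimensional `V ⊆ Q_H` is the image of a finite-dimensional `W ⊆ Q_G`, and then
`dim V_n ≤ dim W_n`; if `f : Q_H → Q_G` is injective, `W = f V` satisfies `dim V_n = dim W_n`
(`exists_growth_le_of_surjective`, `exists_growth_le_of_injective`). So each growth function of
`Q_H` is bounded by a growth function of `Q_G`, and the three assertions follow by comparison. For
subexponential growth the comparison also needs `1 ≤ dim V_n`, that is `Q_H ≠ 0`. -/

namespace AlgebraGrowth

universe w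

variable {k : Type u} {R : Type v} {S : Type w} [Field k] [Ring R] [Algebra k R] [Ring S]
  [Algebra k S]

theorem fg_sum_range_pow {V : Submodule k R} (hV : V.FG) (n : ℕ) :
    (∑ j ∈ Finset.range (n + 1), V ^ j : Submodule k R).FG := by
  induction n with
  | zero => simpa using hV.pow 0
  | succ n ih =>
    rw [Finset.sum_range_succ]
    exact ih.sup (hV.pow _)

theorem map_sum_range_pow (f : R →ₐ[k] S) (V : Submodule k R) (n : ℕ) :
    (∑ j ∈ Finset.range (n + 1), V ^ j).map f.toLinearMap =
      ∑ j ∈ Finset.range (n + 1), V.map f.toLinearMap ^ j := by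
  refine (map_sum (Submodule.mapHom f) (fun j => V ^ j) (Finset.range (n + 1))).trans ?_
  exact Finset.sum_congr rfl fun j _ => map_pow (Submodule.mapHom f) V j

theorem growth_map_le (f : R →ₐ[k] S) {V : Submodule k R} (hV : V.FG) (n : ℕ) :
    growth (V.map f.toLinearMap) n ≤ growth V n := by
  have := Module.Finite.iff_fg.2 (fg_sum_range_pow hV n)
  rw [growth, growth, ← map_sum_range_pow]
  exact Submodule.finrank_map_le _ _

theorem growth_map_of_injective (f : R →ₐ[k] S) (hf : Function.Injective f)
    (V : Submodule k R) (n : ℕ) : growth (V.map f.toLinearMap) n = growth V n := by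
  rw [growth, growth, ← map_sum_range_pow]
  exact (Submodule.equivMapOfInjective f.toLinearMap hf _).finrank_eq.symm

theorem exists_growth_le_of_surjective (f : R →ₐ[k] S) (hf : Function.Surjective f)
    (V : Submodule k S) (hV : FiniteDimensional k V) :
    ∃ W : Submodule k R, FiniteDimensional k W ∧ ∀ n, growth V n ≤ growth W n := by
  classical
  obtain ⟨s, rfl⟩ := Module.Finite.iff_fg.1 hV
  obtain ⟨t, rfl⟩ : ∃ t : Finset R, t.image f = s :=
    ⟨s.image (Function.surjInv hf), by
      simp [Finset.image_image, Function.comp_def, Function.surjInv_eq hf]⟩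
  refine ⟨Submodule.span k t, inferInstance, fun n => ?_⟩
  have h := growth_map_le f (Submodule.fg_span t.finite_toSet) n
  rw [Submodule.map_span] at h
  simpa using h

theorem exists_growth_le_of_injective (f : S →ₐ[k] R) (hf : Function.Injective f)
    (V : Submodule k S) (hV : FiniteDimensional k V) :
    ∃ W : Submodule k R, FiniteDimensional k W ∧ ∀ n, growth V n ≤ growth W n :=
  ⟨V.map f.toLinearMap, inferInstance, fun n => (growth_map_of_injective f hf V n).ge⟩

theorem one_le_growth [Nontrivial R] {V : Submodule k R} (hV : V.FG) (n : ℕ) :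
    1 ≤ growth V n := by
  have := Module.Finite.iff_fg.2 (fg_sum_range_pow hV n)
  have h1 : (1 : R) ∈ (∑ j ∈ Finset.range (n + 1), V ^ j : Submodule k R) := by
    rw [Finset.sum_range_succ']
    exact Submodule.mem_sup_right (by simp)
  have : Nontrivial (∑ j ∈ Finset.range (n + 1), V ^ j : Submodule k R) :=
    ⟨⟨⟨1, h1⟩, 0, fun h => one_ne_zero (congrArg Subtype.val h)⟩⟩
  exact Module.finrank_pos

theorem HasPolynomialGrowth.of_growth_le (hR : HasPolynomialGrowth k R)
    (h : ∀ V : Submodule k S, FiniteDimensional k V →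
      ∃ W : Submodule k R, FiniteDimensional k W ∧ ∀ n, growth V n ≤ growth W n) :
    HasPolynomialGrowth k S := by
  intro V hV
  obtain ⟨W, hW, hVW⟩ := h V hV
  obtain ⟨γ, hγ, hO⟩ := hR W hW
  refine ⟨γ, hγ, .trans (.of_norm_le fun n => ?_) hO⟩
  simpa using hVW n

theorem gkDim_le_of_growth_le
    (h : ∀ V : Submodule k S, FiniteDimensional k V →
      ∃ W : Submodule k R, FiniteDimensional k W ∧ ∀ n, growth V n ≤ growth W n) :
    gkDim k S ≤ gkDim k R := by
  refine iSup₂_le fun V hV => ?_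
  obtain ⟨W, hW, hVW⟩ := h V hV
  refine le_iSup₂_of_le W hW (Filter.limsup_le_limsup (.of_forall fun n => ?_))
  refine EReal.coe_le_coe_iff.2 (div_le_div_of_nonneg_right ?_ (Real.log_natCast_nonneg n))
  -- The convention `log 0 = 0` makes the comparison of logarithms valid also for `growth V n = 0`.
  rcases (growth V n).eq_zero_or_pos with h0 | h0
  · rw [h0, Nat.cast_zero, Real.log_zero]
    exact Real.log_natCast_nonneg _
  · exact Real.log_le_log (mod_cast h0) (mod_cast hVW n)

theorem HasSubexponentialGrowth.of_growth_le [Nontrivial S] (hR : HasSubexponentialGrowth k R)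
    (h : ∀ V : Submodule k S, FiniteDimensional k V →
      ∃ W : Submodule k R, FiniteDimensional k W ∧ ∀ n, growth V n ≤ growth W n) :
    HasSubexponentialGrowth k S := by
  intro V hV
  obtain ⟨W, hW, hVW⟩ := h V hV
  refine tendsto_of_tendsto_of_tendsto_of_le_of_le tendsto_const_nhds (hR W hW)
    (fun n => ?_) fun n => ?_
  · exact Real.one_le_rpow (mod_cast one_le_growth (Module.Finite.iff_fg.1 hV) n) (by positivity)
  · exact Real.rpow_le_rpow (by positivity) (mod_cast hVW n) (by positivity)

end AlgebraGrowth

/-- Polynomial and subexponential growth of `Q_G` pass to quantum subgroups and to quotients `H`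
of `G`, and in the polynomial case `dim H ≤ dim G`. -/
theorem proposition4p1 {A : Type*} {B : Type*} [CStarAlgebra A] [CStarAlgebra B]
    (G : CompactQuantumGroup A) (H : CompactQuantumGroup B)
    (hH : H.IsQuantumSubgroup G ∨ H.IsQuantumQuotient G) :
    (AlgebraGrowth.HasPolynomialGrowth ℂ G.polyAlg →
      AlgebraGrowth.HasPolynomialGrowth ℂ H.polyAlg ∧ H.topDim ≤ G.topDim) ∧
    (AlgebraGrowth.HasSubexponentialGrowth ℂ G.polyAlg →
      AlgebraGrowth.HasSubexponentialGrowth ℂ H.polyAlg) := by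
  have h : ∀ V : Submodule ℂ H.polyAlg, FiniteDimensional ℂ V →
      ∃ W : Submodule ℂ G.polyAlg, FiniteDimensional ℂ W ∧
        ∀ n, AlgebraGrowth.growth V n ≤ AlgebraGrowth.growth W n := by
    rcases hH with ⟨π, hπ⟩ | ⟨θ, hθ⟩
    · exact AlgebraGrowth.exists_growth_le_of_surjective π.toAlgHom hπ
    · exact AlgebraGrowth.exists_growth_le_of_injective θ.toAlgHom hθ
  have := H.nontrivial
  exact ⟨fun hG => ⟨hG.of_growth_le h, AlgebraGrowth.gkDim_le_of_growth_le h⟩,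
    fun hG => hG.of_growth_le h⟩
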